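/- Let $D=[d]$ be the set of modes, with sizes $n_\mu$, $\mu\in D$, and let $\mathcal K$ be a hierarchical family of nonempty proper subsets of $D$ (for all $J,S\in\mathcal K$: $J\subseteq S$ or $S\subseteq J$ or $J\cap S=\emptyset$; and $J\ne D\setminus S$). For $v\neq c$ in a tree $G=(V,E)$ with $D\subseteq V$, let $\mathrm{branch}_c(v)$ consist of $v$ and of all vertices $b\ne c,v$ such that $v$ lies on the path from $c$ to $b$, and let $J_c(v)=\mathrm{branch}_c(v)\cap D$. Let $G$ correspond to $\mathcal K$, i.e. $|V|-1=|\mathcal K|$ and $\mathcal K=\{J_{c_0}(v)\mid v\in V\setminus\{c_0\}\}$ for some $c_0\in V$. For $e=\{v,w\}\in E$ let $J_e$ be the one of the sets $J_w(v),J_v(w)$ that belongs to $\mathcal K$. For $S\subseteq V$ let $E_S$ be the set of edges with at least one endpoint in $S$, $\partial E_S$ the set of edges with exactly one endpoint in $S$, and $E_v=E_{\{v\}}$. Let $r=(r^{(J)})_{J\in\mathcal K}$ and let $N=(N_v)_{v\in V}$ be a network of real tensors $(N_v)_{\alpha_v,\{\beta^e\}_{e\in E_v}}$ with $\beta^e\in[r^{(J_e)}]$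 and $\alpha_v\in[n_v]$, where $n_v=1$ (the label $\alpha_v$ is absent) if $v\notin D$. It represents the tensor $X=\tau_r(N)$, $X_{\alpha}=\sum_{\beta^e:\,e\in E}\prod_{v\in V}(N_v)_{\alpha_v,\{\beta^e\}_{e\in E_v}}$. For a root $c\in V$ let $\mathcal N_{\ne c}$ be the linear map that sends a node $\widehat N_c$ to the tensor represented by the network in which $N_c$ is replaced by $\widehat N_c$. Fix $c\in V$, and let $\mathcal S_c\subseteq\mathcal K$ be the subset for which $\mathcal K^{\mathcal S_c}:=(\mathcal K\setminus\mathcal S_c)\cup\{D\setminus J\mid J\in\mathcal S_c\}$ equals $\{J_c(v)\mid v\in V\setminus\{c\}\}$. For $J=J_c(v)\in\mathcal K^{\mathcal S_c}$, $v\ne c$, let $e$ be the last edge on the path from $c$ to $v$ and $w$ its other endpoint. Let $Y^{(J)}\in\mathbb R^{n_J\times r^{(J_e)}}$ and $Z^{(J)}\in\mathbb R^{r^{(J_e)}\times n_{D\setminus J}}$ be the contractions of the nodes in $\mathrm{branch}_c(v)$ and in $\mathrm{branch}_v(w)=V\setminus\mathrm{branch}_c(v)$, respectively, with $\beta^e$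 left open, and let $H^{(J)}=Z^{(J)}(Z^{(J)})^T$. Assume that $(Y^{(J)})^TY^{(J)}=I$ for all $J\in\mathcal K^{\mathcal S_c}$. Let $\gamma>0$, $\hat J\in\mathcal K^{\mathcal S_c}$, and let $v_{c,\hat J}\neq c$ be the vertex with $J_c(v_{c,\hat J})=\hat J$. Let $\mathcal W^{(\hat J)}$ be the operator on tensors given by $(\mathcal W^{(\hat J)}(X'))^{[\hat J]}=W^{(\hat J)}(X')^{[\hat J]}$, where $(\cdot)^{[\hat J]}$ is the matricization with rows indexed by $\alpha_{\hat J}$, and where $W^{(\hat J)}$ is either $(X^{[\hat J]}(X^{[\hat J]})^T+\gamma I)^{-1}$ or $Y^{(\hat J)}(H^{(\hat J)}+\gamma I)^{-1}(Y^{(\hat J)})^T$. Let $p$ be the set of vertices strictly between $c$ and $v_{c,\hat J}$, let $e_1$ and $\hat e$ be the first and the last edge on the path from $c$ to $v_{c,\hat J}$ (so $e_1=\hat e$ if $p=\emptyset$), and let $E_Y=\partial E_{\{c\}\cup p}$. Theorem. In both cases the matrix $A^{(\hat J)}$ of $\mathcal N_{\ne c}^*\circ\mathcal W^{(\hat J)}\circ\mathcal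 N_{\ne c}$ with respect to the standard basis has the entries $$A^{(\hat J)}_{\alpha_c',\{{\beta^e}'\}_{e\in E_c};\,\alpha_c,\{\beta^e\}_{e\in E_c}}=\delta_{\alpha_c',\alpha_c}\Big(\prod_{e\in E_c\setminus\{e_1\}}\delta_{{\beta^e}',\beta^e}\Big)M^{(\hat J)}_{{\beta^{e_1}}',\beta^{e_1}},$$ where $$M^{(\hat J)}_{{\beta^{e_1}}',\beta^{e_1}}=\sum_{\substack{{\beta^e}',\beta^e:\,e\in E_p\setminus\{e_1\}\\ \alpha_v:\,v\in p}}\Big(\prod_{e\in\partial E_p\setminus\{e_1,\hat e\}}\delta_{{\beta^e}',\beta^e}\Big)\Big(\prod_{v\in p}(N_v)_{\alpha_v,\{{\beta^e}'\}_{e\in E_v}}(N_v)_{\alpha_v,\{\beta^e\}_{e\in E_v}}\Big)(H^{(\hat J)}+\gamma I)^{-1}_{{\beta^{\hat e}}',\beta^{\hat e}}$$ (so $M^{(\hat J)}=(H^{(\hat J)}+\gamma I)^{-1}$ if $p=\emptyset$). Moreover, $$H^{(\hat J)}_{{\beta^{\hat e}}',\beta^{\hat e}}=\sum_{\substack{{\beta^e}',\beta^e:\,e\in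 E_{\{c\}\cup p}\setminus\{\hat e\}\\ \alpha_v:\,v\in\{c\}\cup p}}\Big(\prod_{e\in E_Y\setminus\{\hat e\}}\delta_{{\beta^e}',\beta^e}\Big)\prod_{v\in\{c\}\cup p}(N_v)_{\alpha_v,\{{\beta^e}'\}_{e\in E_v}}(N_v)_{\alpha_v,\{\beta^e\}_{e\in E_v}}.$$ -/

import Mathlib

noncomputable section

/-- Joint index set of a collection `F` of labels, the label `x` ranging over `[size x]`. -/
abbrev LabelIdx {κ : Type*} (size : κ → ℕ) (F : Finset κ) : Type _ :=
  (x : F) → Fin (size x)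

/-- Restriction of a joint index to fewer labels. -/
def restrictIdx {κ : Type*} {size : κ → ℕ} {F' F : Finset κ} (h : F' ⊆ F)
    (α : LabelIdx size F) : LabelIdx size F' :=
  fun x => α ⟨x.1, h x.2⟩

/-- The Kronecker delta. -/
def kronecker {κ : Type*} [DecidableEq κ] (x y : κ) : ℝ := if x = y then 1 else 0

/-- A (finite) tree with vertex set `V`; `modes ⊆ V` plays the role of the set `[d]` of tensor
modes, and `modeSize μ` is the size `n_μ` of the mode `μ ∈ modes` (its values at other vertices
are irrelevant). -/
structure TensorTree (V : Type*) where
  graph : SimpleGraph V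
  isTree : graph.IsTree
  modes : Finset V
  modeSize : V → ℕ

/-- Hierarchical families of nonempty proper subsets of `D`. -/
def IsHierarchical {V : Type*} [DecidableEq V] (D : Finset V) (K : Finset (Finset V)) : Prop :=
  (∀ J ∈ K, J.Nonempty ∧ J ⊂ D) ∧
    ∀ J ∈ K, ∀ S ∈ K, (J ⊆ S ∨ S ⊆ J ∨ Disjoint J S) ∧ J ≠ D \ S

/-- `K^S`: each member of `S ⊆ K` is replaced by its complement in `D`. -/
def switchFamily {V : Type*} [DecidableEq V] (D : Finset V) (K S : Finset (Finset V)) :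
    Finset (Finset V) :=
  (K \ S) ∪ S.image (fun J => D \ J)

theorem subset_of_mem_switchFamily {V : Type*} [DecidableEq V] {D : Finset V}
    {K S : Finset (Finset V)} (hK : IsHierarchical D K) {J : Finset V}
    (hJ : J ∈ switchFamily D K S) : J ⊆ D := by
  rcases Finset.mem_union.1 hJ with h | h
  · exact (hK.1 J (Finset.mem_sdiff.1 h).1).2.subset
  · obtain ⟨J', -, rfl⟩ := Finset.mem_image.1 h
    exact Finset.sdiff_subset

section Matricization

variable {V : Type*} [DecidableEq V] (n : V → ℕ) {D J : Finset V}

/-- Splitting a multi-index over `D` into the parts over `J` and over `D \ J`. -/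
def splitIdx (hJ : J ⊆ D) : LabelIdx n D ≃ LabelIdx n J × LabelIdx n (D \ J) where
  toFun α := (restrictIdx hJ α, restrictIdx Finset.sdiff_subset α)
  invFun p μ := if h : μ.1 ∈ J then p.1 ⟨μ.1, h⟩
    else p.2 ⟨μ.1, Finset.mem_sdiff.2 ⟨μ.2, h⟩⟩
  left_inv α := by
    funext μ
    by_cases h : μ.1 ∈ J <;> simp [h, restrictIdx]
  right_inv p := by
    refine Prod.ext ?_ ?_
    · funext μ
      simp [restrictIdx]
    · funext μ
      have h := (Finset.mem_sdiff.1 μ.2).2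
      simp [restrictIdx, h]

/-- The matricization `X^{[J]}`. -/
def matricize (hJ : J ⊆ D) (X : EuclideanSpace ℝ (LabelIdx n D)) :
    Matrix (LabelIdx n J) (LabelIdx n (D \ J)) ℝ :=
  Matrix.of fun a b => X ((splitIdx n hJ).symm (a, b))

/-- The linear operator on tensors determined by `(𝒲 X)^{[J]} = W X^{[J]}`. -/
def weightOperator (hJ : J ⊆ D) (W : Matrix (LabelIdx n J) (LabelIdx n J) ℝ) :
    EuclideanSpace ℝ (LabelIdx n D) →ₗ[ℝ] EuclideanSpace ℝ (LabelIdx n D) where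
  toFun X := WithLp.toLp 2 fun α =>
    (W * matricize n hJ X) (splitIdx n hJ α).1 (splitIdx n hJ α).2
  map_add' X Y := by
    have h : matricize n hJ (X + Y) = matricize n hJ X + matricize n hJ Y := rfl
    rw [h, Matrix.mul_add]
    rfl
  map_smul' t X := by
    have h : matricize n hJ (t • X) = t • matricize n hJ X := rfl
    rw [h, Matrix.mul_smul]
    rfl

theorem matricize_weightOperator (hJ : J ⊆ D) (W : Matrix (LabelIdx n J) (LabelIdx n J) ℝ)
    (X : EuclideanSpace ℝ (LabelIdx n D)) :
    matricize n hJ (weightOperator n hJ W X) = W * matricize n hJ X := by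
  ext a b
  simp only [matricize, weightOperator, LinearMap.coe_mk, AddHom.coe_mk, Matrix.of_apply,
    Equiv.apply_symm_apply]

/-- The weight `W_{γ,X}^{(J)} = (X^{[J]} (X^{[J]})ᵀ + γ I)⁻¹`. -/
def fullWeight (hJ : J ⊆ D) (γ : ℝ) (X : EuclideanSpace ℝ (LabelIdx n D)) :
    Matrix (LabelIdx n J) (LabelIdx n J) ℝ :=
  (matricize n hJ X * (matricize n hJ X).transpose + γ • (1 : Matrix _ _ ℝ))⁻¹

end Matricization

namespace TensorTree

section Graph

/-- The unique path from `c` to `v`. -/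
def treePath {V : Type*} (T : TensorTree V) (c v : V) : T.graph.Walk c v :=
  (T.isTree.existsUnique_path c v).choose

theorem treePath_isPath {V : Type*} (T : TensorTree V) (c v : V) : (T.treePath c v).IsPath :=
  (T.isTree.existsUnique_path c v).choose_spec.1

theorem eq_treePath {V : Type*} (T : TensorTree V) {c v : V} {q : T.graph.Walk c v}
    (hq : q.IsPath) : q = T.treePath c v :=
  (T.isTree.existsUnique_path c v).unique hq (T.treePath_isPath c v)

/-- The first vertex after `c` on the path to `v` (it is `v` if `c` and `v` are adjacent). -/
def firstStep {V : Type*} (T : TensorTree V) (c v : V) : V := (T.treePath c v).snd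

/-- The predecessor of `v` relative to `c`: the last vertex before `v` on the path from `c`
(it is `c` if `c` and `v` are adjacent). -/
def pred {V : Type*} (T : TensorTree V) (c v : V) : V := (T.treePath c v).penultimate

variable {V : Type*} [Fintype V] [DecidableEq V] (T : TensorTree V)

/-- The vertices strictly between `c` and `v`. -/
def between (c v : V) : Finset V := (T.treePath c v).support.toFinset \ {c, v}

/-- `branch_c(v)`, for `v ≠ c`. -/
def branch (c v : V) : Finset V :=
  insert v (Finset.univ.filter fun b => b ≠ c ∧ b ≠ v ∧ v ∈ T.between c b)

/-- `J_c(v) = branch_c(v) ∩ [d]`. -/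
def modesBelow (c v : V) : Finset V := T.modes ∩ T.branch c v

open Classical in
/-- `E_S`: the edges with at least one endpoint in `S`. -/
def incident (S : Finset V) : Finset (Sym2 V) :=
  Finset.univ.filter fun e => e ∈ T.graph.edgeSet ∧ ∃ u ∈ S, u ∈ e

open Classical in
/-- `∂E_S`: the edges with exactly one endpoint in `S`. -/
def boundary (S : Finset V) : Finset (Sym2 V) :=
  T.incident S \ Finset.univ.filter fun e => e ∈ T.graph.edgeSet ∧ ∀ u ∈ e, u ∈ S

/-- `T` is a tree corresponding to the family `K`: for some root `c`, the sets `J_c(v)`, `v ≠ c`,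
are exactly the members of `K`, without repetition. -/
def CorrespondsTo (K : Finset (Finset V)) : Prop :=
  K.card + 1 = Fintype.card V ∧ ∃ c : V, K = (Finset.univ.erase c).image (T.modesBelow c)

open Classical in
/-- `J_e`: the one of the two sets `J_v(w)`, `J_w(v)`, `e = {v, w}`, that belongs to `K`. -/
def edgeModes (K : Finset (Finset V)) (e : Sym2 V) : Finset V :=
  if h : ∃ J ∈ K, ∃ v w, e = s(v, w) ∧ J = T.modesBelow w v then h.choose else ∅

theorem adj_pred {c v : V} (h : v ≠ c) : T.graph.Adj (T.pred c v) v :=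
  SimpleGraph.Walk.adj_penultimate fun hn => h hn.eq.symm

theorem pred_mem {c v : V} (h : v ≠ c) : T.pred c v ∈ insert c (T.between c v) := by
  have h1 := (T.adj_pred h).ne
  have h2 : T.pred c v ∈ (T.treePath c v).support := SimpleGraph.Walk.getVert_mem_support _ _
  by_cases hc : T.pred c v = c <;> simp [between, hc, h1, h2]

theorem mem_branch {c v u : V} (h : v ≠ c) :
    u ∈ T.branch c v ↔ v ∈ (T.treePath c u).support := by
  have h0 : (T.treePath c c) = SimpleGraph.Walk.nil :=
    (T.eq_treePath SimpleGraph.Walk.IsPath.nil).symm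
  by_cases huv : u = v
  · subst huv; simp [branch]
  · by_cases huc : u = c
    · subst huc; simp [branch, huv, h0, h]
    · simp [branch, between, huv, huc, h, Ne.symm huv]

/-- Removing the edge `{pred_c(v), v}` splits the tree into the two complementary branches. -/
theorem branch_pred {c v : V} (h : v ≠ c) :
    T.branch v (T.pred c v) = (T.branch c v)ᶜ := by
  have hadj := T.adj_pred h
  ext u
  rw [Finset.mem_compl, T.mem_branch h, T.mem_branch hadj.ne]
  constructor
  · intro h1 h2
    obtain ⟨q, r, hq, hr, he⟩ := (T.treePath_isPath c u).mem_support_iff_exists_append.1 h2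
    have hp := T.treePath_isPath c u
    rw [he] at hp
    rw [← T.eq_treePath hr] at h1
    have hq' : T.pred c v ∈ q.support := by
      rw [T.eq_treePath hq]; exact SimpleGraph.Walk.getVert_mem_support _ _
    exact SimpleGraph.Walk.IsPath.ne_of_mem_support_of_append hp hadj.ne hq' h1 rfl
  · intro h1
    obtain ⟨d, hd⟩ : ∃ d : T.graph.Walk c (T.pred c v), v ∉ d.support := by
      have h2 := T.treePath_isPath c v
      rw [← SimpleGraph.Walk.concat_dropLast hadj] at h2
      exact ⟨_, ((SimpleGraph.Walk.concat_isPath_iff _).1 h2).2⟩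
    let w : T.graph.Walk (T.pred c v) u := (d.reverse.append (T.treePath c u)).bypass
    have hw : v ∉ w.support := by
      intro h3
      have h4 := SimpleGraph.Walk.support_bypass_subset_support _ h3
      rw [SimpleGraph.Walk.support_append, List.mem_append, SimpleGraph.Walk.support_reverse,
        List.mem_reverse] at h4
      exact h4.elim hd fun h5 => h1 (List.mem_of_mem_tail h5)
    have hpath : (SimpleGraph.Walk.cons hadj.symm w).IsPath :=
      (SimpleGraph.Walk.cons_isPath_iff _ _).2 ⟨SimpleGraph.Walk.bypass_isPath _, hw⟩
    rw [← T.eq_treePath hpath]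
    simp

theorem edge_mem_incident {S : Finset V} {u w : V} (h : T.graph.Adj u w) (hu : u ∈ S ∨ w ∈ S) :
    s(u, w) ∈ T.incident S := by
  simp only [incident, Finset.mem_filter, Finset.mem_univ, true_and, SimpleGraph.mem_edgeSet]
  exact ⟨h, hu.elim (fun h => ⟨u, h, Sym2.mem_mk_left u w⟩) fun h => ⟨w, h, Sym2.mem_mk_right u w⟩⟩

theorem firstEdge_mem_incident {c v : V} (h : v ≠ c) :
    s(c, T.firstStep c v) ∈ T.incident {c} :=
  T.edge_mem_incident (SimpleGraph.Walk.adj_snd fun hn => h hn.eq.symm)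
    (Or.inl (Finset.mem_singleton_self c))

theorem incident_mono {S S' : Finset V} (h : S ⊆ S') : T.incident S ⊆ T.incident S' := by
  intro e he
  simp only [incident, Finset.mem_filter, Finset.mem_univ, true_and] at he ⊢
  obtain ⟨h1, u, hu, h2⟩ := he
  exact ⟨h1, u, h hu, h2⟩

theorem modes_inter_branch_pred {c v : V} (h : v ≠ c) :
    T.modes ∩ T.branch v (T.pred c v) ⊆ T.modes \ T.modesBelow c v := by
  rw [T.branch_pred h]
  intro u hu
  simp only [Finset.mem_inter, Finset.mem_compl, modesBelow, Finset.mem_sdiff] at hu ⊢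
  tauto

end Graph

section Network

variable {V : Type*} [Fintype V] [DecidableEq V] (T : TensorTree V) (r : Sym2 V → ℕ)

/-- Indices of a node at `v`: the label `α_v` (present only if `v ∈ [d]`; otherwise the first
factor has exactly one element) and the labels `β^e`, `e ∈ E_v`. -/
abbrev NodeIdx (v : V) : Type _ :=
  LabelIdx T.modeSize (T.modes ∩ {v}) × LabelIdx r (T.incident {v})

/-- Full tensors in `ℝ^{n_1 × ⋯ × n_d}`. -/
abbrev Tensor : Type _ := EuclideanSpace ℝ (LabelIdx T.modeSize T.modes)

/-- The data space: one node for each vertex, `r e` being the range of `β^e`. -/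
abbrev Network : Type _ := (v : V) → EuclideanSpace ℝ (T.NodeIdx r v)

variable {T r}

/-- `∏_{v ∈ S} (N_v)_{α_v, {β^e}_{e ∈ E_v}}`. -/
def nodeProd (N : T.Network r) (S : Finset V) (α : LabelIdx T.modeSize (T.modes ∩ S))
    (β : LabelIdx r (T.incident S)) : ℝ :=
  ∏ u : S, N u.1
    (restrictIdx (Finset.inter_subset_inter_left (Finset.singleton_subset_iff.2 u.2)) α,
      restrictIdx (T.incident_mono (Finset.singleton_subset_iff.2 u.2)) β)

/-- The represented tensor `τ_r(N)`. -/
def represent (N : T.Network r) : T.Tensor :=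
  WithLp.toLp 2 fun α => ∑ β : LabelIdx r (T.incident Finset.univ),
    nodeProd N Finset.univ (restrictIdx Finset.inter_subset_left α) β

/-- `Y^{(J)}` for `J = J_c(v)`: the contraction of the nodes in `branch_c(v)`. -/
def innerFactor (N : T.Network r) {c v : V} (h : v ≠ c) :
    Matrix (LabelIdx T.modeSize (T.modesBelow c v)) (Fin (r s(T.pred c v, v))) ℝ :=
  Matrix.of fun α b =>
    ∑ β : LabelIdx r (T.incident (T.branch c v)) with
      β ⟨s(T.pred c v, v), T.edge_mem_incident (T.adj_pred h)
        (Or.inr (Finset.mem_insert_self _ _))⟩ = b,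
      nodeProd N (T.branch c v) α β

/-- `Z^{(J)}` for `J = J_c(v)`: the contraction of the nodes on the other side of the edge
`{pred_c(v), v}`. -/
def outerFactor (N : T.Network r) {c v : V} (h : v ≠ c) :
    Matrix (Fin (r s(T.pred c v, v))) (LabelIdx T.modeSize (T.modes \ T.modesBelow c v)) ℝ :=
  Matrix.of fun b α =>
    ∑ β : LabelIdx r (T.incident (T.branch v (T.pred c v))) with
      β ⟨s(T.pred c v, v), T.edge_mem_incident (T.adj_pred h)
        (Or.inl (Finset.mem_insert_self _ _))⟩ = b,
      nodeProd N (T.branch v (T.pred c v)) (restrictIdx (T.modes_inter_branch_pred h) α) β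

/-- `H^{(J)} = Z^{(J)} (Z^{(J)})ᵀ`. -/
def gram (N : T.Network r) {c v : V} (h : v ≠ c) :
    Matrix (Fin (r s(T.pred c v, v))) (Fin (r s(T.pred c v, v))) ℝ :=
  outerFactor N h * (outerFactor N h).transpose

/-- The matrix `(H^{(J)} + γ I)⁻¹`. -/
def gramInv (N : T.Network r) {c v : V} (h : v ≠ c) (γ : ℝ) :
    Matrix (Fin (r s(T.pred c v, v))) (Fin (r s(T.pred c v, v))) ℝ :=
  (gram N h + γ • (1 : Matrix _ _ ℝ))⁻¹

/-- The low rank weight `W_{γ,N,c}^{(J)} = Y^{(J)} (H^{(J)} + γ I)⁻¹ (Y^{(J)})ᵀ`. -/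
def lowRankWeight (N : T.Network r) {c v : V} (h : v ≠ c) (γ : ℝ) :
    Matrix (LabelIdx T.modeSize (T.modesBelow c v))
      (LabelIdx T.modeSize (T.modesBelow c v)) ℝ :=
  innerFactor N h * gramInv N h γ * (innerFactor N h).transpose

theorem nodeProd_update (N : T.Network r) (c : V) (x : EuclideanSpace ℝ (T.NodeIdx r c))
    (α : LabelIdx T.modeSize (T.modes ∩ Finset.univ)) (β : LabelIdx r (T.incident Finset.univ)) :
    nodeProd (Function.update N c x) Finset.univ α β =
      x (restrictIdx (Finset.inter_subset_inter_left (Finset.subset_univ _)) α,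
          restrictIdx (T.incident_mono (Finset.subset_univ _)) β) *
        ∏ u ∈ (Finset.univ : Finset (Finset.univ : Finset V)).erase ⟨c, Finset.mem_univ c⟩,
          N u.1 (restrictIdx
              (Finset.inter_subset_inter_left (Finset.singleton_subset_iff.2 u.2)) α,
            restrictIdx (T.incident_mono (Finset.singleton_subset_iff.2 u.2)) β) := by
  unfold nodeProd
  rw [← Finset.mul_prod_erase _ _ (Finset.mem_univ ⟨c, Finset.mem_univ c⟩)]
  congr 1
  · simp
  · refine Finset.prod_congr rfl fun u hu => ?_
    have hne : u.1 ≠ c := fun h => (Finset.mem_erase.1 hu).1 (Subtype.ext h)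
    rw [Function.update_of_ne hne]

/-- The linear map `𝒩_{≠c}`: all nodes but the one at `c` are kept fixed. -/
def embedAt (N : T.Network r) (c : V) : EuclideanSpace ℝ (T.NodeIdx r c) →ₗ[ℝ] T.Tensor where
  toFun x := represent (Function.update N c x)
  map_add' x y := by
    ext α
    simp only [represent, nodeProd_update, PiLp.add_apply, add_mul, Finset.sum_add_distrib]
  map_smul' t x := by
    ext α
    simp only [represent, nodeProd_update, PiLp.smul_apply, smul_eq_mul, RingHom.id_apply,
      Finset.mul_sum, mul_assoc]

/-- The matrix of `𝒩_{≠c}^* ∘ 𝒲 ∘ 𝒩_{≠c}` with respect to the standard basis. The row index is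
`(α_c', {β^e'})`, the column index is `(α_c, {β^e})`. -/
def pullbackMatrix (N : T.Network r) (c : V) (W : T.Tensor →ₗ[ℝ] T.Tensor) :
    Matrix (T.NodeIdx r c) (T.NodeIdx r c) ℝ :=
  LinearMap.toMatrix (EuclideanSpace.basisFun (T.NodeIdx r c) ℝ).toBasis
    (EuclideanSpace.basisFun (T.NodeIdx r c) ℝ).toBasis
    (LinearMap.adjoint (embedAt N c) ∘ₗ W ∘ₗ embedAt N c)

/-- `∏_{e ∈ B} δ_{β^e', β^e}`, for a set `B` of edges. -/
def deltaProd {F : Finset (Sym2 V)} (B : Finset (Sym2 V)) (β' β : LabelIdx r F) : ℝ :=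
  ∏ e : F with e.1 ∈ B, kronecker (β' e) (β e)

/-- The contraction over the path from `c` (exclusive) to `v` (exclusive) that yields
`M^{(J)}`, `J = J_c(v)`. With `p` the set of vertices strictly between `c` and `v`,
`e₁` the first edge and `ê` the last edge of the path from `c` to `v`, the labels of all edges in
`E_p` (and `e₁`, `ê`, which belong to `E_p` unless `p` is empty) except `e₁` are summed over. -/
def pathContraction (N : T.Network r) {c v : V} (h : v ≠ c) (γ : ℝ) :
    Matrix (Fin (r s(c, T.firstStep c v))) (Fin (r s(c, T.firstStep c v))) ℝ :=
  let p := T.between c v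
  let e₁ := s(c, T.firstStep c v)
  let eHat := s(T.pred c v, v)
  let F := T.incident p ∪ {e₁, eHat}
  have h₁ : e₁ ∈ F := Finset.mem_union_right _ (Finset.mem_insert_self _ _)
  have hHat : eHat ∈ F :=
    Finset.mem_union_right _ (Finset.mem_insert_of_mem (Finset.mem_singleton_self _))
  Matrix.of fun b' b =>
    ∑ β' : LabelIdx r F with β' ⟨e₁, h₁⟩ = b',
      ∑ β : LabelIdx r F with β ⟨e₁, h₁⟩ = b,
        ∑ α : LabelIdx T.modeSize (T.modes ∩ p),
          deltaProd (T.boundary p \ {e₁, eHat}) β' β *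
            (nodeProd N p α (restrictIdx Finset.subset_union_left β') *
              nodeProd N p α (restrictIdx Finset.subset_union_left β)) *
            gramInv N h γ (β' ⟨eHat, hHat⟩) (β ⟨eHat, hHat⟩)

/-- The contraction over the root `c` and the path towards `v` that yields `H^{(J)}`,
`J = J_c(v)`. With `ê` the last edge of the path from `c` to `v`, the labels of all edges in
`E_{{c} ∪ p}` except `ê` are summed over. -/
def rootPathContraction (N : T.Network r) {c v : V} (h : v ≠ c) :
    Matrix (Fin (r s(T.pred c v, v))) (Fin (r s(T.pred c v, v))) ℝ :=
  let q := insert c (T.between c v)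
  let eHat := s(T.pred c v, v)
  have hHat : eHat ∈ T.incident q := T.edge_mem_incident (T.adj_pred h) (Or.inl (T.pred_mem h))
  Matrix.of fun b' b =>
    ∑ β' : LabelIdx r (T.incident q) with β' ⟨eHat, hHat⟩ = b',
      ∑ β : LabelIdx r (T.incident q) with β ⟨eHat, hHat⟩ = b,
        ∑ α : LabelIdx T.modeSize (T.modes ∩ q),
          deltaProd (T.boundary q \ {eHat}) β' β * (nodeProd N q α β' * nodeProd N q α β)

end Network

end TensorTree

end

/-! Cutting the edge ê above `v` factors the matricized tensor as X = Y Z (`matricize_represent`).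
The branch of `v` does not contain the root `c`, so replacing the root node changes only Z. For unit
vectors at `c` with indices x' and x, giving outer factors Z' and Z, the matrix entry is therefore
the Frobenius inner product of Y Z' and W Y Z, that is, tr(Z'ᵀ (Yᵀ W Y) Z).

Both weights collapse to the same small matrix: Yᵀ W Y = (H + γI)⁻¹ (`transpose_mul_weight_mul`).
For the low rank weight this is Yᵀ Y = I. For the full one, X Xᵀ = Y H Yᵀ gives (X Xᵀ + γI) Y = Y (H
+ γI), and inverting both sides yields W Y = Y (H + γI)⁻¹. The entry becomes the sum of (H +
γI)⁻¹ₖ'ₖ (Z' Zᵀ)ₖ'ₖ.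

It remains to evaluate Z' Zᵀ, a contraction of two networks, differing at most at `c`, over all
vertices outside the branch of `v`. A branch hanging off the path from `c` to `v` contributes its
own Yᵀ Y = I, so it may be cut off at the price of a Kronecker delta on its connecting edge
(`crossContraction_union_branch`). Only `c` and the vertices strictly between `c` and `v` survive
(`outerFactor_mul_transpose_eq`). Equal networks give the formula for H. Unit vectors at `c` fix all
labels at the root, and what is left is the contraction M over the path
(`sum_gramInv_mul_crossContraction`). -/

set_option linter.unusedSectionVars false

/-! ### Splitting sums over joint indices -/

section Labels

variable {κ : Type*} {size : κ → ℕ} {F G H : Finset κ}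

theorem restrictIdx_apply (h : F ⊆ H) (α : LabelIdx size H) (x : F) :
    restrictIdx h α x = α ⟨x.1, h x.2⟩ := rfl

theorem restrictIdx_restrictIdx (h : F ⊆ G) (h' : G ⊆ H) (α : LabelIdx size H) :
    restrictIdx h (restrictIdx h' α) = restrictIdx (h.trans h') α := rfl

/-- Multi-indices over a union are the compatible pairs of multi-indices over the two parts. -/
theorem sum_restrictIdx_union [DecidableEq κ] (hF : F ⊆ H) (hG : G ⊆ H) (hH : H ⊆ F ∪ G)
    (P : LabelIdx size F → LabelIdx size G → Prop) [∀ a, DecidablePred (P a)]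
    (hP : ∀ a b, P a b ↔ ∀ x (hx : x ∈ F) (hx' : x ∈ G), b ⟨x, hx'⟩ = a ⟨x, hx⟩)
    (f : LabelIdx size F → LabelIdx size G → ℝ) :
    ∑ β : LabelIdx size H, f (restrictIdx hF β) (restrictIdx hG β) =
      ∑ a : LabelIdx size F, ∑ b : LabelIdx size G with P a b, f a b := by
  rw [Finset.sum_sigma']
  refine Finset.sum_bij (fun β _ => ⟨restrictIdx hF β, restrictIdx hG β⟩) ?_ ?_ ?_ ?_
  · intro β _
    refine Finset.mem_sigma.2 ⟨Finset.mem_univ _, Finset.mem_filter.2 ⟨Finset.mem_univ _, ?_⟩⟩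
    exact (hP _ _).2 fun _ _ _ => rfl
  · intro β _ β' _ h
    have h1 := congrArg Sigma.fst h
    have h2 : restrictIdx hG β = restrictIdx hG β' := by
      simpa using (Sigma.mk.inj_iff.1 h).2
    funext x
    rcases Finset.mem_union.1 (hH x.2) with hx | hx
    · exact congrFun h1 ⟨x.1, hx⟩
    · exact congrFun h2 ⟨x.1, hx⟩
  · rintro ⟨a, b⟩ hab
    simp only [Finset.mem_sigma, Finset.mem_filter, Finset.mem_univ, true_and, hP] at hab
    -- The glued index follows `a` on `F` and `b` elsewhere; compatibility makes it restrict to `b`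
    -- on all of `G`.
    refine ⟨fun x => if hx : x.1 ∈ F then a ⟨x.1, hx⟩ else
      b ⟨x.1, (Finset.mem_union.1 (hH x.2)).resolve_left hx⟩, Finset.mem_univ _, ?_⟩
    have h1 : restrictIdx hF (fun x : H => if hx : x.1 ∈ F then a ⟨x.1, hx⟩ else
        b ⟨x.1, (Finset.mem_union.1 (hH x.2)).resolve_left hx⟩) = a := by
      funext x
      simp [restrictIdx]
    have h2 : restrictIdx hG (fun x : H => if hx : x.1 ∈ F then a ⟨x.1, hx⟩ else
        b ⟨x.1, (Finset.mem_union.1 (hH x.2)).resolve_left hx⟩) = b := by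
      funext x
      by_cases hx : x.1 ∈ F
      · simp [restrictIdx, hx, hab x.1 hx x.2]
      · simp [restrictIdx, hx]
    rw [h1, h2]
  · intro β _
    rfl

/-- Gluing multi-indices along the only common label `e`. -/
theorem sum_restrictIdx_glue [DecidableEq κ] (hF : F ⊆ H) (hG : G ⊆ H) (hH : H ⊆ F ∪ G) {e : κ}
    (heF : e ∈ F) (heG : e ∈ G) (he : ∀ x ∈ F, x ∈ G → x = e)
    (p : LabelIdx size F → Prop) [DecidablePred p] (f : LabelIdx size F → LabelIdx size G → ℝ) :
    ∑ β : LabelIdx size H with p (restrictIdx hF β), f (restrictIdx hF β) (restrictIdx hG β) =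
      ∑ a : LabelIdx size F with p a, ∑ b : LabelIdx size G with b ⟨e, heG⟩ = a ⟨e, heF⟩,
        f a b := by
  -- The constraint `p` moves into the summand as an `if`, so that the unconstrained gluing applies;
  -- agreement on the overlap means agreement at `e`.
  rw [Finset.sum_filter, Finset.sum_filter, sum_restrictIdx_union hF hG hH
    (fun a b => b ⟨e, heG⟩ = a ⟨e, heF⟩) (fun a b => ⟨fun h x hx hx' => by
      obtain rfl := he x hx hx'; exact h, fun h => h e heF heG⟩)
    (fun a b => if p a then f a b else 0)]
  refine Finset.sum_congr rfl fun a _ => ?_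
  by_cases h : p a <;> simp [h]

theorem sum_sum_restrictIdx_glue [DecidableEq κ] (hF : F ⊆ H) (hG : G ⊆ H) (hH : H ⊆ F ∪ G)
    {e : κ} (heF : e ∈ F) (heG : e ∈ G) (he : ∀ x ∈ F, x ∈ G → x = e)
    (f : LabelIdx size F → LabelIdx size G → LabelIdx size F → LabelIdx size G → ℝ) :
    ∑ β' : LabelIdx size H, ∑ β : LabelIdx size H,
        f (restrictIdx hF β') (restrictIdx hG β') (restrictIdx hF β) (restrictIdx hG β) =
      ∑ a' : LabelIdx size F, ∑ b' : LabelIdx size G with b' ⟨e, heG⟩ = a' ⟨e, heF⟩,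
        ∑ a : LabelIdx size F, ∑ b : LabelIdx size G with b ⟨e, heG⟩ = a ⟨e, heF⟩,
          f a' b' a b := by
  have h := sum_restrictIdx_glue (size := size) hF hG hH heF heG he (fun _ => True)
  simp only [Finset.filter_true] at h
  rw [← h]
  exact Finset.sum_congr rfl fun β' _ => h _

theorem sum_restrictIdx_disjoint [DecidableEq κ] (hF : F ⊆ H) (hG : G ⊆ H) (hH : H ⊆ F ∪ G)
    (he : Disjoint F G) (f : LabelIdx size F → LabelIdx size G → ℝ) :
    ∑ β : LabelIdx size H, f (restrictIdx hF β) (restrictIdx hG β) =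
      ∑ a : LabelIdx size F, ∑ b : LabelIdx size G, f a b := by
  rw [sum_restrictIdx_union hF hG hH (fun _ _ => True)
    (fun a b => ⟨fun _ x hx hx' => (Finset.disjoint_left.1 he hx hx').elim, fun _ => trivial⟩)]
  simp

theorem sum_restrictIdx_of_subset [DecidableEq κ] (hF : F ⊆ H) (hH : H ⊆ F)
    (f : LabelIdx size F → ℝ) :
    ∑ β : LabelIdx size H, f (restrictIdx hF β) = ∑ a : LabelIdx size F, f a := by
  obtain rfl := hF.antisymm hH
  rfl

end Labels

namespace TensorTree

/-! ### The ancestor order of the tree rooted at `c` -/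

section Rooted

variable {V : Type*} [Fintype V] [DecidableEq V] (T : TensorTree V) {a b c u v w : V}

theorem treePath_self (c : V) : T.treePath c c = SimpleGraph.Walk.nil :=
  (T.eq_treePath SimpleGraph.Walk.IsPath.nil).symm

/-- `T.le c a b`: the vertex `a` lies on the path from `c` to `b`. -/
def le (c a b : V) : Prop := a ∈ (T.treePath c b).support

theorem le_refl (c a : V) : T.le c a a := SimpleGraph.Walk.end_mem_support _

theorem root_le (c a : V) : T.le c c a := SimpleGraph.Walk.start_mem_support _

theorem eq_root_of_le (h : T.le c a c) : a = c := by
  simpa [le, treePath_self] using h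

theorem treePath_eq_append (h : T.le c a b) :
    ∃ q : T.graph.Walk a b, T.treePath c b = (T.treePath c a).append q := by
  obtain ⟨p, q, hp, hq, he⟩ := (T.treePath_isPath c b).mem_support_iff_exists_append.1 h
  exact ⟨q, by rw [he, T.eq_treePath hp]⟩

theorem le_trans (h : T.le c a b) (h' : T.le c b u) : T.le c a u := by
  obtain ⟨q, hq⟩ := T.treePath_eq_append h'
  rw [le, hq, SimpleGraph.Walk.mem_support_append_iff]
  exact Or.inl h

theorem le_antisymm (h : T.le c a b) (h' : T.le c b a) : a = b := by
  obtain ⟨q, hq⟩ := T.treePath_eq_append h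
  obtain ⟨q', hq'⟩ := T.treePath_eq_append h'
  have h1 := congrArg SimpleGraph.Walk.length hq
  have h2 := congrArg SimpleGraph.Walk.length hq'
  rw [SimpleGraph.Walk.length_append] at h1 h2
  -- Each of the two paths extends the other, so by comparing lengths both extensions are empty.
  exact SimpleGraph.Walk.eq_of_length_eq_zero (p := q) (by omega)

/-- The ancestors of `u` are the vertices of one path, hence form a chain. This is what rules out
overlaps between branches later on. -/
theorem le_total_of_le (h : T.le c a u) (h' : T.le c b u) : T.le c a b ∨ T.le c b a := by
  obtain ⟨q, hq⟩ := T.treePath_eq_append h'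
  have ha := h
  rw [le, hq, SimpleGraph.Walk.mem_support_append_iff] at ha
  refine ha.imp id fun ha => ?_
  have hp := T.treePath_isPath c u
  rw [← SimpleGraph.Walk.take_spec q ha] at hq
  rw [hq, SimpleGraph.Walk.append_assoc] at hp
  rw [le, ← T.eq_treePath hp.of_append_left]
  simp

theorem treePath_eq_concat (h : v ≠ c) :
    T.treePath c v = (T.treePath c (T.pred c v)).concat (T.adj_pred h) := by
  have h2 := T.treePath_isPath c v
  have h3 := SimpleGraph.Walk.concat_dropLast (T.adj_pred h)
  rw [← h3] at h2
  have h4 : (T.treePath c v).dropLast = T.treePath c (T.pred c v) :=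
    T.eq_treePath ((SimpleGraph.Walk.concat_isPath_iff _).1 h2).1
  exact h3.symm.trans
    (congrArg (fun q : T.graph.Walk c (T.pred c v) => q.concat (T.adj_pred h)) h4)

theorem le_iff_of_ne (h : v ≠ c) : T.le c a v ↔ T.le c a (T.pred c v) ∨ a = v := by
  rw [le, T.treePath_eq_concat h, SimpleGraph.Walk.support_concat]
  simp [le]

theorem pred_le (h : v ≠ c) : T.le c (T.pred c v) v :=
  (T.le_iff_of_ne h).2 (Or.inl (T.le_refl _ _))

theorem not_le_pred (h : v ≠ c) : ¬ T.le c v (T.pred c v) := fun h' =>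
  (T.adj_pred h).ne (T.le_antisymm (T.pred_le h) h')

/-- Appending the edge to the path from `c` to `u` gives a path again, which must be the path to
`w`. -/
theorem eq_pred_of_adj_of_not_le (h : T.graph.Adj u w) (h' : ¬ T.le c w u) :
    w ≠ c ∧ u = T.pred c w := by
  refine ⟨fun e => h' (e ▸ T.root_le c u), ?_⟩
  have hp : ((T.treePath c u).concat h).IsPath :=
    (SimpleGraph.Walk.concat_isPath_iff _).2 ⟨T.treePath_isPath c u, h'⟩
  rw [pred, ← T.eq_treePath hp]
  simp

theorem eq_pred_or_eq_pred (c : V) (h : T.graph.Adj u w) :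
    (w ≠ c ∧ u = T.pred c w) ∨ (u ≠ c ∧ w = T.pred c u) := by
  by_cases h1 : T.le c w u
  · exact Or.inr (T.eq_pred_of_adj_of_not_le h.symm fun h2 => h.ne (T.le_antisymm h2 h1))
  · exact Or.inl (T.eq_pred_of_adj_of_not_le h h1)

/-- Together with `edge_inj`, this labels edges by their lower endpoints. Identities between edge
sets then become propositional statements about `w` and its predecessor. -/
theorem exists_edge_eq (c : V) {e : Sym2 V} (he : e ∈ T.graph.edgeSet) :
    ∃ w, w ≠ c ∧ e = s(T.pred c w, w) := by
  induction e with | _ x y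
  rcases T.eq_pred_or_eq_pred c he with ⟨h, h'⟩ | ⟨h, h'⟩
  · exact ⟨y, h, by rw [← h']⟩
  · exact ⟨x, h, by rw [← h', Sym2.eq_swap]⟩

theorem edge_inj (hu : u ≠ c) (hw : w ≠ c) :
    s(T.pred c u, u) = s(T.pred c w, w) ↔ u = w := by
  refine ⟨fun h => ?_, fun h => by rw [h]⟩
  rcases Sym2.eq_iff.1 h with ⟨-, h⟩ | ⟨h1, h2⟩
  · exact h
  · have h3 := T.pred_le hu
    have h4 := T.pred_le hw
    rw [h1] at h3
    rw [← h2] at h4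
    exact T.le_antisymm h4 h3

theorem firstStep_adj (h : v ≠ c) : T.graph.Adj c (T.firstStep c v) :=
  SimpleGraph.Walk.adj_snd fun hn => h hn.eq.symm

theorem firstStep_ne (h : v ≠ c) : T.firstStep c v ≠ c := (T.firstStep_adj h).ne'

theorem firstStep_le (c v : V) : T.le c (T.firstStep c v) v :=
  SimpleGraph.Walk.getVert_mem_support _ _

theorem pred_firstStep (h : v ≠ c) : T.pred c (T.firstStep c v) = c := by
  rcases T.eq_pred_or_eq_pred c (T.firstStep_adj h) with h | h
  · exact h.2.symm
  · exact (h.1 rfl).elim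

/-- Two vertices of the path to `v` are comparable, and a child of the root has no proper ancestor
but the root. -/
theorem eq_firstStep_iff (h : v ≠ c) (hw : w ≠ c) (hwv : T.le c w v) :
    T.pred c w = c ↔ w = T.firstStep c v := by
  refine ⟨fun hp => ?_, fun hp => hp ▸ T.pred_firstStep h⟩
  rcases T.le_total_of_le hwv (T.firstStep_le c v) with h1 | h1
  · rw [T.le_iff_of_ne (T.firstStep_ne h), T.pred_firstStep h] at h1
    exact h1.resolve_left fun h2 => hw (T.eq_root_of_le h2)
  · rw [T.le_iff_of_ne hw, hp] at h1
    exact (h1.resolve_left fun h2 => T.firstStep_ne h (T.eq_root_of_le h2)).symm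

theorem mem_branch_iff_le (h : v ≠ c) : u ∈ T.branch c v ↔ T.le c v u := T.mem_branch h

theorem root_notMem_branch (h : v ≠ c) : c ∉ T.branch c v := fun h' =>
  h (T.eq_root_of_le ((T.mem_branch_iff_le h).1 h'))

theorem mem_between : u ∈ T.between c v ↔ T.le c u v ∧ u ≠ c ∧ u ≠ v := by
  simp [between, le]

theorem mem_incident_edge (hw : w ≠ c) {S : Finset V} :
    s(T.pred c w, w) ∈ T.incident S ↔ T.pred c w ∈ S ∨ w ∈ S := by
  refine ⟨fun h => ?_, fun h => T.edge_mem_incident (T.adj_pred hw) h⟩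
  simp only [incident, Finset.mem_filter, Finset.mem_univ, true_and] at h
  obtain ⟨-, x, hx, h⟩ := h
  rcases Sym2.mem_iff.1 h with rfl | rfl
  · exact Or.inl hx
  · exact Or.inr hx

theorem mem_boundary_edge (hw : w ≠ c) {S : Finset V} :
    s(T.pred c w, w) ∈ T.boundary S ↔
      (T.pred c w ∈ S ∧ w ∉ S) ∨ (T.pred c w ∉ S ∧ w ∈ S) := by
  rw [boundary, Finset.mem_sdiff, T.mem_incident_edge hw]
  simp [T.adj_pred hw]
  tauto

theorem exists_edge_of_mem_incident (c : V) {S : Finset V} {e : Sym2 V} (he : e ∈ T.incident S) :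
    ∃ w, w ≠ c ∧ e = s(T.pred c w, w) := by
  simp only [incident, Finset.mem_filter, Finset.mem_univ, true_and] at he
  exact T.exists_edge_eq c he.1

theorem boundary_subset_incident (S : Finset V) : T.boundary S ⊆ T.incident S :=
  Finset.sdiff_subset

theorem incident_union (A B : Finset V) : T.incident (A ∪ B) = T.incident A ∪ T.incident B := by
  ext e
  simp only [incident, Finset.mem_filter, Finset.mem_univ, true_and, Finset.mem_union]
  grind

end Rooted

/-! ### Products of node entries and of Kronecker deltas -/

section Products

variable {V : Type*} [Fintype V] [DecidableEq V] {T : TensorTree V} {r : Sym2 V → ℕ}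

theorem nodeProd_union (N : T.Network r) {S A B : Finset V} (hA : A ⊆ S) (hB : B ⊆ S)
    (hS : S ⊆ A ∪ B) (hAB : Disjoint A B) (α : LabelIdx T.modeSize (T.modes ∩ S))
    (β : LabelIdx r (T.incident S)) :
    nodeProd N S α β =
      nodeProd N A (restrictIdx (Finset.inter_subset_inter_left hA) α)
        (restrictIdx (T.incident_mono hA) β) *
      nodeProd N B (restrictIdx (Finset.inter_subset_inter_left hB) α)
        (restrictIdx (T.incident_mono hB) β) := by
  -- Rewriting the factors as one function on `V` lets products over different vertex sets be
  -- combined; the value 1 outside `S` never enters.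
  have key : ∀ (A : Finset V) (hA : A ⊆ S), nodeProd N A
      (restrictIdx (Finset.inter_subset_inter_left hA) α) (restrictIdx (T.incident_mono hA) β) =
      ∏ u ∈ A, if hu : u ∈ S then
        N u (restrictIdx
            (Finset.inter_subset_inter_left (Finset.singleton_subset_iff.2 hu)) α,
          restrictIdx (T.incident_mono (Finset.singleton_subset_iff.2 hu)) β) else 1 := by
    intro A hA
    rw [← Finset.prod_coe_sort, nodeProd]
    refine Finset.prod_congr rfl fun u _ => ?_
    rw [dif_pos (hA u.2)]
    rfl
  rw [key A hA, key B hB, ← Finset.prod_union hAB, ← hS.antisymm (Finset.union_subset hA hB),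
    ← key S Finset.Subset.rfl]
  rfl

theorem nodeProd_congr {N N' : T.Network r} {S : Finset V} (h : ∀ u ∈ S, N u = N' u) :
    nodeProd N S = nodeProd N' S := by
  funext α β
  exact Finset.prod_congr rfl fun u _ => by rw [h u.1 u.2]

theorem nodeProd_singleton (N : T.Network r) (u : V) (α : LabelIdx T.modeSize (T.modes ∩ {u}))
    (β : LabelIdx r (T.incident {u})) : nodeProd N {u} α β = N u (α, β) := by
  rw [nodeProd, Fintype.prod_subsingleton _ ⟨u, Finset.mem_singleton_self u⟩]
  rfl

/-- Only labels in `B` are compared, so forgetting labels outside `B` does no harm. -/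
theorem deltaProd_restrictIdx {F F' B : Finset (Sym2 V)} (hF : F' ⊆ F) (hB : B ∩ F ⊆ F')
    (β' β : LabelIdx r F) :
    deltaProd B (restrictIdx hF β') (restrictIdx hF β) = deltaProd B β' β := by
  refine Finset.prod_bij (fun e _ => ⟨e.1, hF e.2⟩) ?_ ?_ ?_ ?_
  · intro e he
    exact Finset.mem_filter.2 ⟨Finset.mem_univ _, (Finset.mem_filter.1 he).2⟩
  · intro e _ e' _ h
    exact Subtype.ext (Subtype.mk.inj h)
  · intro e he
    have h := (Finset.mem_filter.1 he).2
    exact ⟨⟨e.1, hB (Finset.mem_inter.2 ⟨h, e.2⟩)⟩,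
      Finset.mem_filter.2 ⟨Finset.mem_univ _, h⟩, rfl⟩
  · intro e _
    rfl

theorem deltaProd_union {F B B' : Finset (Sym2 V)} (h : Disjoint B B') (β' β : LabelIdx r F) :
    deltaProd (B ∪ B') β' β = deltaProd B β' β * deltaProd B' β' β := by
  rw [deltaProd, deltaProd, deltaProd, ← Finset.prod_union]
  · congr 1
    ext e
    simp
  · rw [Finset.disjoint_left] at h ⊢
    intro e he he'
    exact h (by simpa using he) (by simpa using he')

theorem deltaProd_singleton {F : Finset (Sym2 V)} {e : Sym2 V} (h : e ∈ F)
    (β' β : LabelIdx r F) : deltaProd {e} β' β = kronecker (β' ⟨e, h⟩) (β ⟨e, h⟩) := by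
  rw [deltaProd, Finset.prod_eq_single ⟨e, h⟩]
  · intro e' he' hne
    exact (hne (Subtype.ext (by simpa using he'))).elim
  · simp

end Products

/-! ### Factorization along an edge and removal of orthonormal branches -/

section Contraction

variable {V : Type*} [Fintype V] [DecidableEq V] {T : TensorTree V} {r : Sym2 V → ℕ}
  {c v w : V}

/-- The two sides of the edge above `v` partition the vertices and share no other edge label, so the
network sum is a matrix product over that label. -/
theorem matricize_represent (N : T.Network r) (h : v ≠ c) (hJ : T.modesBelow c v ⊆ T.modes) :
    matricize T.modeSize hJ (represent N) = innerFactor N h * outerFactor N h := by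
  ext a b
  have hsplit := (splitIdx T.modeSize hJ).apply_symm_apply (a, b)
  set α := (splitIdx T.modeSize hJ).symm (a, b) with hα
  have ha : restrictIdx hJ α = a := congrArg Prod.fst hsplit
  have hb : restrictIdx Finset.sdiff_subset α = b := congrArg Prod.snd hsplit
  have hcompl := T.branch_pred h
  have hcover : Finset.univ ⊆ T.branch c v ∪ T.branch v (T.pred c v) := by
    rw [hcompl, Finset.union_compl]
  have hdisj : Disjoint (T.branch c v) (T.branch v (T.pred c v)) := by
    rw [hcompl]; exact disjoint_compl_right
  have hsum := sum_restrictIdx_glue (size := r)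
    (T.incident_mono (Finset.subset_univ (T.branch c v)))
    (T.incident_mono (Finset.subset_univ (T.branch v (T.pred c v))))
    ((T.incident_mono hcover).trans (T.incident_union _ _).subset)
    (e := s(T.pred c v, v))
    (T.edge_mem_incident (T.adj_pred h) (Or.inr (Finset.mem_insert_self _ _)))
    (T.edge_mem_incident (T.adj_pred h) (Or.inl (Finset.mem_insert_self _ _)))
    (by
      intro e he he'
      obtain ⟨u, hu, rfl⟩ := T.exists_edge_of_mem_incident c he
      rw [hcompl] at he'
      rw [T.mem_incident_edge hu] at he he'
      simp only [Finset.mem_compl, T.mem_branch_iff_le h] at he he'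
      rw [T.edge_inj hu h]
      have h1 := T.le_iff_of_ne (a := v) hu
      grind)
    (fun _ => True)
    (fun β₁ β₂ => nodeProd N (T.branch c v) a β₁ *
      nodeProd N (T.branch v (T.pred c v)) (restrictIdx (T.modes_inter_branch_pred h) b) β₂)
  simp only [Finset.filter_true] at hsum
  have hX : matricize T.modeSize hJ (represent N) a b =
      ∑ β : LabelIdx r (T.incident Finset.univ),
        nodeProd N (T.branch c v) a (restrictIdx (T.incident_mono (Finset.subset_univ _)) β) *
          nodeProd N (T.branch v (T.pred c v)) (restrictIdx (T.modes_inter_branch_pred h) b)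
            (restrictIdx (T.incident_mono (Finset.subset_univ _)) β) := by
    conv_rhs => rw [← hb, ← ha]
    refine Finset.sum_congr rfl fun β _ => ?_
    rw [nodeProd_union N (Finset.subset_univ _) (Finset.subset_univ _) hcover hdisj]
    rfl
  -- Grouping by the value of the shared label produces the summation index of the matrix product.
  rw [hX, hsum, Matrix.mul_apply, ← Finset.sum_fiberwise _ (fun β₁ : LabelIdx r
    (T.incident (T.branch c v)) => β₁ ⟨s(T.pred c v, v), T.edge_mem_incident (T.adj_pred h)
        (Or.inr (Finset.mem_insert_self _ _))⟩)]
  refine Finset.sum_congr rfl fun k _ => ?_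
  rw [innerFactor, outerFactor, Matrix.of_apply, Matrix.of_apply, Finset.sum_mul]
  refine Finset.sum_congr rfl fun β₁ hβ₁ => ?_
  rw [(Finset.mem_filter.1 hβ₁).2, Finset.mul_sum]

/-- Contraction of the nodes of two networks over the vertices of `S`: the labels of all edges in
`E_S` except `e` are summed over, those of the edges in `∂E_S \ {e}` being identified. -/
noncomputable def crossContraction (N' N : T.Network r) (S : Finset V) (e : Sym2 V)
    (he : e ∈ T.incident S) :
    Matrix (Fin (r e)) (Fin (r e)) ℝ :=
  Matrix.of fun b' b =>
    ∑ β' : LabelIdx r (T.incident S) with β' ⟨e, he⟩ = b',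
      ∑ β : LabelIdx r (T.incident S) with β ⟨e, he⟩ = b,
        ∑ α : LabelIdx T.modeSize (T.modes ∩ S),
          deltaProd (T.boundary S \ {e}) β' β * (nodeProd N' S α β' * nodeProd N S α β)

/-- The edge above `v` is the only boundary edge of the outer side, so no deltas occur: the two
networks are coupled by the modes alone. -/
theorem outerFactor_mul_transpose (N' N : T.Network r) (h : v ≠ c) :
    outerFactor N' h * (outerFactor N h).transpose =
      crossContraction N' N (T.branch v (T.pred c v)) s(T.pred c v, v)
        (T.edge_mem_incident (T.adj_pred h) (Or.inl (Finset.mem_insert_self _ _))) := by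
  ext b' b
  have hB : T.boundary (T.branch v (T.pred c v)) \ {s(T.pred c v, v)} = ∅ := by
    refine Finset.eq_empty_of_forall_notMem fun e he => ?_
    obtain ⟨h1, h2⟩ := Finset.mem_sdiff.1 he
    obtain ⟨u, hu, rfl⟩ := T.exists_edge_of_mem_incident c (T.boundary_subset_incident _ h1)
    rw [Finset.mem_singleton, T.edge_inj hu h] at h2
    rw [T.mem_boundary_edge hu, T.branch_pred h] at h1
    simp only [Finset.mem_compl, T.mem_branch_iff_le h] at h1
    have h3 := T.le_iff_of_ne (a := v) hu
    grind
  have hsub : T.modes \ T.modesBelow c v ⊆ T.modes ∩ T.branch v (T.pred c v) := by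
    rw [T.branch_pred h, modesBelow]
    intro u hu
    simp only [Finset.mem_sdiff, Finset.mem_inter, Finset.mem_compl] at hu ⊢
    tauto
  simp only [crossContraction, Matrix.of_apply, hB, Matrix.mul_apply, Matrix.transpose_apply,
    outerFactor]
  rw [sum_restrictIdx_of_subset (T.modes_inter_branch_pred h) hsub (fun α =>
    (∑ β' : LabelIdx r (T.incident (T.branch v (T.pred c v))) with
      β' ⟨s(T.pred c v, v), T.edge_mem_incident (T.adj_pred h)
        (Or.inl (Finset.mem_insert_self _ _))⟩ = b',
      nodeProd N' (T.branch v (T.pred c v)) α β') *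
    ∑ β : LabelIdx r (T.incident (T.branch v (T.pred c v))) with
      β ⟨s(T.pred c v, v), T.edge_mem_incident (T.adj_pred h)
        (Or.inl (Finset.mem_insert_self _ _))⟩ = b,
      nodeProd N (T.branch v (T.pred c v)) α β)]
  simp only [Finset.sum_mul_sum, deltaProd, Finset.notMem_empty, Finset.filter_false,
    Finset.prod_empty, one_mul]
  rw [Finset.sum_comm]
  refine Finset.sum_congr rfl fun β' _ => ?_
  rw [Finset.sum_comm]

theorem sum_innerFactor_mul {N : T.Network r} (hw : w ≠ c)
    (hY : (innerFactor N hw).transpose * innerFactor N hw = 1)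
    (k' k : Fin (r s(T.pred c w, w))) :
    ∑ α, innerFactor N hw α k' * innerFactor N hw α k = kronecker k' k := by
  have h := congrFun (congrFun hY k') k
  rw [Matrix.mul_apply, Matrix.one_apply] at h
  exact h

/-- Orthonormality of the basis of a branch removes that branch from a contraction. -/
theorem crossContraction_union_branch {N' N : T.Network r} (hN : ∀ u, u ≠ c → N' u = N u)
    (hw : w ≠ c) (hY : (innerFactor N hw).transpose * innerFactor N hw = 1)
    {S : Finset V} (hS : ∀ u ∈ S, ∀ a, T.le c a u → a ∈ S) (hwS : w ∉ S) (hpS : T.pred c w ∈ S)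
    {e : Sym2 V} (he : e ∈ T.incident S) (hne : e ≠ s(T.pred c w, w)) :
    crossContraction N' N (S ∪ T.branch c w) e (T.incident_mono Finset.subset_union_left he) =
      crossContraction N' N S e he := by
  have hdisj : Disjoint S (T.branch c w) := by
    rw [Finset.disjoint_left]
    intro u hu hu'
    exact hwS (hS u hu w ((T.mem_branch_iff_le hw).1 hu'))
  have hlow : ∀ u, u ≠ c → u ∈ S → T.pred c u ∈ S := fun u hu h => hS u h _ (T.pred_le hu)
  have hup : ∀ u, u ≠ c → T.pred c u ∈ T.branch c w → u ∈ T.branch c w := fun u hu h => by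
    rw [T.mem_branch_iff_le hw] at h ⊢
    exact T.le_trans h (T.pred_le hu)
  have hup' : ∀ u, u ≠ c → u ∈ T.branch c w → T.pred c u ∈ T.branch c w ∨ u = w := fun u hu h => by
    rw [T.mem_branch_iff_le hw] at h ⊢
    exact ((T.le_iff_of_ne hu).1 h).imp id Eq.symm
  have hwB : w ∈ T.branch c w := Finset.mem_insert_self _ _
  have hmem : ∀ u, u ∈ S → u ∉ T.branch c w := fun u h => Finset.disjoint_left.1 hdisj h
  have heS : s(T.pred c w, w) ∈ T.incident S := T.edge_mem_incident (T.adj_pred hw) (Or.inl hpS)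
  have heB : s(T.pred c w, w) ∈ T.incident (T.branch c w) :=
    T.edge_mem_incident (T.adj_pred hw) (Or.inr hwB)
  have hcommon : ∀ x ∈ T.incident S, x ∈ T.incident (T.branch c w) → x = s(T.pred c w, w) := by
    intro x hx hx'
    obtain ⟨u, hu, rfl⟩ := T.exists_edge_of_mem_incident c hx
    rw [T.mem_incident_edge hu] at hx hx'
    rw [T.edge_inj hu hw]
    grind
  -- The branch is closed under descendants, so its only boundary edge is the one above `w`. That
  -- edge is interior to the union but on the boundary of `S`, which accounts for the one extra
  -- delta.
  have hbd : T.boundary S \ {e} =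
      (T.boundary (S ∪ T.branch c w) \ {e}) ∪ {s(T.pred c w, w)} := by
    ext x
    by_cases hx : x ∈ T.graph.edgeSet
    · obtain ⟨u, hu, rfl⟩ := T.exists_edge_eq c hx
      simp only [Finset.mem_union, Finset.mem_sdiff, Finset.mem_singleton,
        T.mem_boundary_edge hu, T.edge_inj hu hw]
      grind
    · have h1 : ∀ S, x ∉ T.boundary S := fun S h => hx (by
        have := T.boundary_subset_incident _ h
        simp only [incident, Finset.mem_filter] at this
        exact this.2.1)
      have h2 : x ≠ s(T.pred c w, w) := fun h => hx (h ▸ T.adj_pred hw)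
      simp [h1, h2]
  have hbd1 : Disjoint (T.boundary (S ∪ T.branch c w) \ {e}) {s(T.pred c w, w)} := by
    rw [Finset.disjoint_singleton_right, Finset.mem_sdiff, T.mem_boundary_edge hw]
    grind
  have hbd2 : (T.boundary (S ∪ T.branch c w) \ {e}) ∩ T.incident (S ∪ T.branch c w) ⊆
      T.incident S :=
    Finset.inter_subset_left.trans ((Finset.subset_union_left.trans hbd.superset).trans
      (Finset.sdiff_subset.trans (T.boundary_subset_incident S)))
  have hnB : nodeProd N' (T.branch c w) = nodeProd N (T.branch c w) :=
    nodeProd_congr fun u hu => hN u fun h => T.root_notMem_branch hw (h ▸ hu)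
  ext b' b
  simp only [crossContraction, Matrix.of_apply]
  have hα : ∀ β' β : LabelIdx r (T.incident (S ∪ T.branch c w)),
      ∑ α : LabelIdx T.modeSize (T.modes ∩ (S ∪ T.branch c w)),
        deltaProd (T.boundary (S ∪ T.branch c w) \ {e}) β' β *
          (nodeProd N' (S ∪ T.branch c w) α β' * nodeProd N (S ∪ T.branch c w) α β) =
      ∑ α₁ : LabelIdx T.modeSize (T.modes ∩ S),
        ∑ α₂ : LabelIdx T.modeSize (T.modes ∩ T.branch c w),
        deltaProd (T.boundary (S ∪ T.branch c w) \ {e})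
          (restrictIdx (T.incident_mono Finset.subset_union_left) β')
          (restrictIdx (T.incident_mono Finset.subset_union_left) β) *
          ((nodeProd N' S α₁ (restrictIdx (T.incident_mono Finset.subset_union_left) β') *
            nodeProd N (T.branch c w) α₂
              (restrictIdx (T.incident_mono Finset.subset_union_right) β')) *
          (nodeProd N S α₁ (restrictIdx (T.incident_mono Finset.subset_union_left) β) *
            nodeProd N (T.branch c w) α₂
              (restrictIdx (T.incident_mono Finset.subset_union_right) β))) := by
    intro β' β
    rw [← sum_restrictIdx_disjoint
      (Finset.inter_subset_inter_left Finset.subset_union_left)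
      (Finset.inter_subset_inter_left Finset.subset_union_right)
      (Finset.inter_union_distrib_left _ _ _).subset
      (hdisj.mono Finset.inter_subset_right Finset.inter_subset_right)]
    refine Finset.sum_congr rfl fun α _ => ?_
    rw [deltaProd_restrictIdx (T.incident_mono Finset.subset_union_left) hbd2,
      nodeProd_union N' Finset.subset_union_left Finset.subset_union_right
        Finset.Subset.rfl hdisj, hnB,
      nodeProd_union N Finset.subset_union_left Finset.subset_union_right
        Finset.Subset.rfl hdisj]
  simp only [hα]
  have hglue := fun b => sum_restrictIdx_glue (size := r)
    (T.incident_mono Finset.subset_union_left) (T.incident_mono Finset.subset_union_right)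
    (T.incident_union S (T.branch c w)).subset heS heB hcommon
    (fun β => β ⟨e, he⟩ = b)
  -- The sums over β and then β' are split into labels at `S` and labels at the branch, coupled only
  -- at the edge above `w`.
  have hβ := fun β'₁ β'₂ => hglue b (fun β₁ β₂ =>
    ∑ α₁ : LabelIdx T.modeSize (T.modes ∩ S),
        ∑ α₂ : LabelIdx T.modeSize (T.modes ∩ T.branch c w),
        deltaProd (T.boundary (S ∪ T.branch c w) \ {e}) β'₁ β₁ *
          ((nodeProd N' S α₁ β'₁ * nodeProd N (T.branch c w) α₂ β'₂) *
          (nodeProd N S α₁ β₁ * nodeProd N (T.branch c w) α₂ β₂)))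
  refine (Finset.sum_congr rfl fun β' _ => hβ _ _).trans ?_
  refine (hglue b' (fun β'₁ β'₂ => ∑ β₁ : LabelIdx r (T.incident S) with β₁ ⟨e, he⟩ = b,
    ∑ β₂ : LabelIdx r (T.incident (T.branch c w)) with β₂ ⟨_, heB⟩ = β₁ ⟨_, heS⟩,
    ∑ α₁ : LabelIdx T.modeSize (T.modes ∩ S),
        ∑ α₂ : LabelIdx T.modeSize (T.modes ∩ T.branch c w),
        deltaProd (T.boundary (S ∪ T.branch c w) \ {e}) β'₁ β₁ *
          ((nodeProd N' S α₁ β'₁ * nodeProd N (T.branch c w) α₂ β'₂) *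
          (nodeProd N S α₁ β₁ * nodeProd N (T.branch c w) α₂ β₂)))).trans ?_
  refine Finset.sum_congr rfl fun β'₁ _ => ?_
  rw [Finset.sum_comm]
  refine Finset.sum_congr rfl fun β₁ _ => ?_
  -- The extra delta is expanded, through orthonormality, into the very sum over the branch that
  -- stands on the other side; only reordering of sums remains.
  rw [hbd, deltaProd_union hbd1, deltaProd_singleton heS,
    ← sum_innerFactor_mul hw hY]
  simp only [innerFactor, Matrix.of_apply, Finset.mul_sum, Finset.sum_mul]
  rw [Finset.sum_congr rfl fun β'₂ _ => Finset.sum_comm]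
  rw [Finset.sum_comm]
  refine Finset.sum_congr rfl fun α₁ _ => ?_
  rw [Finset.sum_congr rfl fun β'₂ _ => Finset.sum_comm]
  rw [Finset.sum_comm]
  refine Finset.sum_congr rfl fun α₂ _ => ?_
  rw [Finset.sum_comm]
  refine Finset.sum_congr rfl fun β₂ _ => ?_
  refine Finset.sum_congr rfl fun β'₂ _ => ?_
  ring

theorem mem_insert_between (h : v ≠ c) {u : V} :
    u ∈ insert c (T.between c v) ↔ T.le c u v ∧ u ≠ v := by
  rw [Finset.mem_insert, mem_between]
  by_cases hu : u = c
  · subst hu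
    simp [T.root_le, h.symm]
  · simp [hu]

/-- With orthonormal bases on all branches, only the nodes on the path between the root and `v`
contribute to the contraction of the part of the tree outside `branch_c(v)`. -/
theorem crossContraction_eq_of_subset {N' N : T.Network r} (hN : ∀ u, u ≠ c → N' u = N u)
    (hY : ∀ (w : V) (hw : w ≠ c), (innerFactor N hw).transpose * innerFactor N hw = 1)
    (h : v ≠ c) (S : Finset V) (hS : ∀ u ∈ S, ∀ a, T.le c a u → a ∈ S)
    (hqS : insert c (T.between c v) ⊆ S) (hSU : S ⊆ T.branch v (T.pred c v)) :
    crossContraction N' N S s(T.pred c v, v)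
        (T.edge_mem_incident (T.adj_pred h) (Or.inl (hqS (T.pred_mem h)))) =
      crossContraction N' N (T.branch v (T.pred c v)) s(T.pred c v, v)
        (T.edge_mem_incident (T.adj_pred h) (Or.inl (Finset.mem_insert_self _ _))) := by
  by_cases hne : S = T.branch v (T.pred c v)
  · subst hne
    rfl
  have hUmem : ∀ u, u ∈ T.branch v (T.pred c v) ↔ ¬ T.le c v u := fun u => by
    rw [T.branch_pred h, Finset.mem_compl, T.mem_branch_iff_le h]
  -- A missing vertex closest to the root has its predecessor in `S`. Adjoining its whole branch
  -- keeps the set closed under ancestors and leaves fewer vertices missing, so the recursion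
  -- terminates.
  obtain ⟨w, hwmem, hmin⟩ := Finset.exists_min_image (T.branch v (T.pred c v) \ S)
    (fun u => (T.treePath c u).length)
    (Finset.sdiff_nonempty.2 fun h' => hne (hSU.antisymm h'))
  obtain ⟨hwU, hwS⟩ := Finset.mem_sdiff.1 hwmem
  have hw : w ≠ c := fun h' => hwS (h' ▸ hqS (Finset.mem_insert_self _ _))
  rw [hUmem] at hwU
  have hpS : T.pred c w ∈ S := by
    by_contra hp
    have h1 := hmin (T.pred c w) (Finset.mem_sdiff.2
      ⟨(hUmem _).2 fun h' => hwU (T.le_trans h' (T.pred_le hw)), hp⟩)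
    rw [T.treePath_eq_concat hw, SimpleGraph.Walk.length_concat] at h1
    omega
  have hwv : w ≠ v := fun h' => hwU (h' ▸ T.le_refl c w)
  rw [← crossContraction_union_branch hN hw (hY w hw) hS hwS hpS _
    fun h' => hwv ((T.edge_inj h hw).1 h').symm]
  have hcard : (T.branch v (T.pred c v) \ (S ∪ T.branch c w)).card <
      (T.branch v (T.pred c v) \ S).card := by
    refine Finset.card_lt_card ⟨Finset.sdiff_subset_sdiff Finset.Subset.rfl
      Finset.subset_union_left, fun h' => ?_⟩
    exact (Finset.mem_sdiff.1 (h' hwmem)).2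
      (Finset.mem_union_right _ (Finset.mem_insert_self _ _))
  refine crossContraction_eq_of_subset hN hY h (S ∪ T.branch c w) ?_
    (hqS.trans Finset.subset_union_left) ?_
  · intro u hu a ha
    rcases Finset.mem_union.1 hu with hu | hu
    · exact Finset.mem_union_left _ (hS u hu a ha)
    · rw [T.mem_branch_iff_le hw] at hu
      rw [Finset.mem_union, T.mem_branch_iff_le hw]
      rcases T.le_total_of_le ha hu with h1 | h1
      · rcases (T.le_iff_of_ne hw).1 h1 with h2 | rfl
        · exact Or.inl (hS _ hpS _ h2)
        · exact Or.inr (T.le_refl _ _)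
      · exact Or.inr h1
  · refine Finset.union_subset hSU fun u hu => ?_
    rw [T.mem_branch_iff_le hw] at hu
    rw [hUmem]
    intro hvu
    -- A vertex below both `v` and `w` makes them comparable: either `w` lies below `v`, outside the
    -- region considered, or `w` is on the path to `v`, already in `S`.
    rcases T.le_total_of_le hvu hu with h1 | h1
    · exact hwU h1
    · exact hwS (hqS ((mem_insert_between h).2 ⟨h1, hwv⟩))
termination_by (T.branch v (T.pred c v) \ S).card

/-- Two different networks are allowed so that one statement serves both H and the matrix entries,
where distinct unit vectors sit at the root. -/
theorem outerFactor_mul_transpose_eq {N' N : T.Network r} (hN : ∀ u, u ≠ c → N' u = N u)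
    (hY : ∀ (w : V) (hw : w ≠ c), (innerFactor N hw).transpose * innerFactor N hw = 1)
    (h : v ≠ c) :
    outerFactor N' h * (outerFactor N h).transpose =
      crossContraction N' N (insert c (T.between c v)) s(T.pred c v, v)
        (T.edge_mem_incident (T.adj_pred h) (Or.inl (T.pred_mem h))) := by
  rw [outerFactor_mul_transpose]
  refine (crossContraction_eq_of_subset hN hY h _ ?_ Finset.Subset.rfl ?_).symm
  · intro u hu a ha
    rw [mem_insert_between h] at hu ⊢
    exact ⟨T.le_trans ha hu.1, fun h' => hu.2 (T.le_antisymm hu.1 (h' ▸ ha))⟩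
  · intro u hu
    rw [mem_insert_between h] at hu
    rw [T.branch_pred h, Finset.mem_compl, T.mem_branch_iff_le h]
    exact fun h' => hu.2 (T.le_antisymm hu.1 h')

theorem gram_eq_rootPathContraction {N : T.Network r}
    (hY : ∀ (w : V) (hw : w ≠ c), (innerFactor N hw).transpose * innerFactor N hw = 1)
    (h : v ≠ c) : gram N h = rootPathContraction N h :=
  outerFactor_mul_transpose_eq (fun _ _ => rfl) hY h

end Contraction

end TensorTree

/-! ### Reduction of the weight to (H + γI)⁻¹ -/

theorem isUnit_det_mul_transpose_add_smul_one {m n : Type*} [Fintype m] [DecidableEq m]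
    [Fintype n] (M : Matrix m n ℝ) {γ : ℝ} (hγ : 0 < γ) :
    IsUnit (M * M.transpose + γ • (1 : Matrix m m ℝ)).det := by
  have h1 : (M * M.transpose).PosSemidef := by
    simpa using Matrix.posSemidef_self_mul_conjTranspose M
  have h2 : (γ • (1 : Matrix m m ℝ)).PosDef := Matrix.PosDef.one.smul hγ
  exact (h2.posSemidef_add h1).det_pos.ne'.isUnit

namespace TensorTree

section Pullback

variable {V : Type*} [Fintype V] [DecidableEq V] {T : TensorTree V} {r : Sym2 V → ℕ}
  {c v : V}

theorem transpose_mul_weight_mul {N : T.Network r} (h : v ≠ c)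
    (hY : (innerFactor N h).transpose * innerFactor N h = 1) {γ : ℝ} (hγ : 0 < γ)
    (hJ : T.modesBelow c v ⊆ T.modes)
    {W : Matrix (LabelIdx T.modeSize (T.modesBelow c v))
      (LabelIdx T.modeSize (T.modesBelow c v)) ℝ}
    (hW : W = fullWeight T.modeSize hJ γ (represent N) ∨ W = lowRankWeight N h γ) :
    (innerFactor N h).transpose * W * innerFactor N h = gramInv N h γ := by
  set Y := innerFactor N h with hYdef
  rcases hW with rfl | rfl
  · have hA := isUnit_det_mul_transpose_add_smul_one
      (matricize T.modeSize hJ (represent N)) hγ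
    have hB : IsUnit (gram N h + γ • (1 : Matrix _ _ ℝ)).det :=
      isUnit_det_mul_transpose_add_smul_one _ hγ
    -- Push-through identity: X Xᵀ = Y H Yᵀ and Yᵀ Y = I give X Xᵀ Y = Y H, and γI commutes past Y.
    -- Both shifted Gram matrices are invertible since γ > 0.
    have hcomm : (matricize T.modeSize hJ (represent N) *
        (matricize T.modeSize hJ (represent N)).transpose + γ • (1 : Matrix _ _ ℝ)) * Y =
        Y * (gram N h + γ • (1 : Matrix _ _ ℝ)) := by
      rw [matricize_represent N h hJ, Matrix.transpose_mul, ← hYdef, gram, Matrix.add_mul,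
        Matrix.mul_add, Matrix.smul_mul, Matrix.mul_smul, Matrix.one_mul, Matrix.mul_one]
      congr 1
      simp only [Matrix.mul_assoc, hY, Matrix.mul_one]
    have hcomm' : fullWeight T.modeSize hJ γ (represent N) * Y = Y * gramInv N h γ := by
      rw [← Matrix.nonsing_inv_mul_cancel_left _ (Y * gramInv N h γ) hA, ← Matrix.mul_assoc _ Y,
        hcomm, gramInv, Matrix.mul_nonsing_inv_cancel_right _ _ hB]
      rfl
    rw [Matrix.mul_assoc, hcomm', ← Matrix.mul_assoc, hY, Matrix.one_mul]
  · rw [lowRankWeight, ← hYdef]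
    simp only [Matrix.mul_assoc, hY, Matrix.mul_one]
    rw [← Matrix.mul_assoc, hY, Matrix.one_mul]

theorem innerFactor_update (N : T.Network r) (x : EuclideanSpace ℝ (T.NodeIdx r c)) {w : V}
    (hw : w ≠ c) : innerFactor (Function.update N c x) hw = innerFactor N hw := by
  have h : nodeProd (Function.update N c x) (T.branch c w) = nodeProd N (T.branch c w) :=
    nodeProd_congr fun u hu =>
      Function.update_of_ne (ne_of_mem_of_not_mem hu (T.root_notMem_branch hw)) _ _
  ext a b
  simp only [innerFactor, Matrix.of_apply, h]

/-- Matricization only rearranges entries, so the inner product of tensors is the Frobenius one. -/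
theorem inner_weightOperator (hJ : T.modesBelow c v ⊆ T.modes)
    (W : Matrix (LabelIdx T.modeSize (T.modesBelow c v))
      (LabelIdx T.modeSize (T.modesBelow c v)) ℝ) (X' X : T.Tensor) :
    inner ℝ X' (weightOperator T.modeSize hJ W X) =
      ((matricize T.modeSize hJ X').transpose * (W * matricize T.modeSize hJ X)).trace := by
  rw [← matricize_weightOperator, PiLp.inner_apply,
    ← (splitIdx T.modeSize hJ).symm.sum_comp, Fintype.sum_prod_type, Finset.sum_comm]
  simp only [Matrix.trace, Matrix.diag, Matrix.mul_apply, Matrix.transpose_apply]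
  refine Finset.sum_congr rfl fun b _ => Finset.sum_congr rfl fun a _ => ?_
  simp [matricize, mul_comm]

theorem pullbackMatrix_apply (N : T.Network r) (W : T.Tensor →ₗ[ℝ] T.Tensor)
    (x' x : T.NodeIdx r c) :
    pullbackMatrix N c W x' x =
      inner ℝ (represent (Function.update N c (EuclideanSpace.single x' 1)))
        (W (represent (Function.update N c (EuclideanSpace.single x 1)))) := by
  have h : ∀ y : EuclideanSpace ℝ (T.NodeIdx r c),
      y x' = inner ℝ (EuclideanSpace.single x' (1 : ℝ)) y := fun y => by
    simp [EuclideanSpace.inner_single_left]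
  rw [pullbackMatrix, LinearMap.toMatrix_apply]
  simp only [OrthonormalBasis.coe_toBasis, EuclideanSpace.basisFun_apply,
    OrthonormalBasis.coe_toBasis_repr_apply, EuclideanSpace.basisFun_repr]
  rw [h, LinearMap.comp_apply, LinearMap.adjoint_inner_right]
  rfl

/-- The entries of the pulled back weight, in terms of the contraction over the path to `v`. -/
theorem pullbackMatrix_weightOperator {N : T.Network r}
    (hY : ∀ (w : V) (hw : w ≠ c), (innerFactor N hw).transpose * innerFactor N hw = 1)
    (h : v ≠ c) {γ : ℝ} (hγ : 0 < γ) (hJ : T.modesBelow c v ⊆ T.modes)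
    {W : Matrix (LabelIdx T.modeSize (T.modesBelow c v))
      (LabelIdx T.modeSize (T.modesBelow c v)) ℝ}
    (hW : W = fullWeight T.modeSize hJ γ (represent N) ∨ W = lowRankWeight N h γ)
    (x' x : T.NodeIdx r c) :
    pullbackMatrix N c (weightOperator T.modeSize hJ W) x' x =
      ∑ k', ∑ k, gramInv N h γ k' k *
        crossContraction (Function.update N c (EuclideanSpace.single x' 1))
          (Function.update N c (EuclideanSpace.single x 1))
          (insert c (T.between c v)) s(T.pred c v, v)
          (T.edge_mem_incident (T.adj_pred h) (Or.inl (T.pred_mem h))) k' k := by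
  rw [pullbackMatrix_apply, inner_weightOperator, matricize_represent _ h,
    matricize_represent _ h, innerFactor_update, innerFactor_update, Matrix.transpose_mul,
    ← outerFactor_mul_transpose_eq (fun u hu => by
      rw [Function.update_of_ne hu, Function.update_of_ne hu])
      (fun w hw => by rw [innerFactor_update, hY w hw]) h]
  generalize outerFactor _ h = Z'
  generalize outerFactor _ h = Z
  rw [show Z'.transpose * (innerFactor N h).transpose * (W * (innerFactor N h * Z)) =
      Z'.transpose * (((innerFactor N h).transpose * W * innerFactor N h) * Z) by
    simp only [Matrix.mul_assoc], transpose_mul_weight_mul h (hY v h) hγ hJ hW,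
    -- Cyclicity of the trace moves Z'ᵀ next to Z, leaving (H + γI)⁻¹ times Z Z'ᵀ, the transpose of
    -- Z' Zᵀ.
    Matrix.trace_mul_comm, Matrix.mul_assoc, Matrix.trace]
  refine Finset.sum_congr rfl fun k' _ => ?_
  rw [Matrix.diag_apply, Matrix.mul_apply]
  refine Finset.sum_congr rfl fun k _ => ?_
  rw [← Matrix.transpose_apply (Z * _), Matrix.transpose_mul, Matrix.transpose_transpose]

end Pullback

/-! ### The root node and the contraction over the path -/

section Path

variable {V : Type*} [Fintype V] [DecidableEq V] {T : TensorTree V} {r : Sym2 V → ℕ}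
  {c v w : V}

theorem firstEdge_eq (h : v ≠ c) :
    s(c, T.firstStep c v) = s(T.pred c (T.firstStep c v), T.firstStep c v) := by
  rw [T.pred_firstStep h]

theorem pathEdges_subset (h : v ≠ c) :
    T.incident (T.between c v) ∪ {s(c, T.firstStep c v), s(T.pred c v, v)} ⊆
      T.incident (insert c (T.between c v)) := by
  refine Finset.union_subset (T.incident_mono (Finset.subset_insert _ _)) ?_
  refine Finset.insert_subset ?_ (Finset.singleton_subset_iff.2 ?_)
  · exact T.edge_mem_incident (T.firstStep_adj h) (Or.inl (Finset.mem_insert_self _ _))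
  · exact T.edge_mem_incident (T.adj_pred h) (Or.inl (T.pred_mem h))

theorem incident_insert_root (c v : V) : T.incident (insert c (T.between c v)) =
    T.incident {c} ∪ T.incident (T.between c v) := by
  rw [Finset.insert_eq, incident_union]

/-- The last edge touches `c` only when nothing lies between `c` and `v`, and then it is the first
edge. Thus the root and the path are glued along a single label, also for an empty path. -/
theorem eq_firstEdge_of_mem (h : v ≠ c) {e : Sym2 V} (he : e ∈ T.incident {c})
    (he' : e ∈ T.incident (T.between c v) ∪ {s(c, T.firstStep c v), s(T.pred c v, v)}) :
    e = s(c, T.firstStep c v) := by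
  obtain ⟨w, hw, rfl⟩ := T.exists_edge_of_mem_incident c he
  rw [firstEdge_eq h] at he' ⊢
  simp only [Finset.mem_union, Finset.mem_insert, Finset.mem_singleton, T.mem_incident_edge hw,
    T.edge_inj hw h, T.edge_inj hw (T.firstStep_ne h), mem_between] at he he' ⊢
  have h1 := fun h1 => T.eq_firstStep_iff h hw h1
  have h2 := T.le_refl c v
  grind

/-- The first edge either becomes interior when the root is joined to the path, or coincides with
the last edge; it carries no delta in either case. -/
theorem boundary_insert_root (h : v ≠ c) :
    T.boundary (insert c (T.between c v)) \ {s(T.pred c v, v)} =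
      (T.incident {c} \ {s(c, T.firstStep c v)}) ∪
        (T.boundary (T.between c v) \ {s(c, T.firstStep c v), s(T.pred c v, v)}) := by
  ext x
  by_cases hx : x ∈ T.graph.edgeSet
  · obtain ⟨w, hw, rfl⟩ := T.exists_edge_eq c hx
    rw [firstEdge_eq h]
    simp only [Finset.mem_union, Finset.mem_sdiff, Finset.mem_singleton, Finset.mem_insert,
      T.mem_boundary_edge hw, T.mem_incident_edge hw, T.edge_inj hw h,
      T.edge_inj hw (T.firstStep_ne h), mem_between]
    have h1 := fun h1 => T.eq_firstStep_iff h hw h1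
    have h2 : T.le c w v → T.le c (T.pred c w) v := T.le_trans (T.pred_le hw)
    have h3 : T.le c w v → T.pred c w ≠ v := fun h3 h4 => T.not_le_pred hw (h4 ▸ h3)
    have h4 := T.firstStep_le c v
    have h5 := T.le_refl c v
    grind
  · have h1 : ∀ S, x ∉ T.incident S := fun S h => hx (by
      simp only [incident, Finset.mem_filter] at h
      exact h.2.1)
    have h2 : ∀ S, x ∉ T.boundary S := fun S h => h1 S (T.boundary_subset_incident S h)
    simp [h1, h2]

theorem disjoint_rootEdges_pathEdges (h : v ≠ c) :
    Disjoint (T.incident {c} \ {s(c, T.firstStep c v)})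
      (T.boundary (T.between c v) \ {s(c, T.firstStep c v), s(T.pred c v, v)}) := by
  rw [Finset.disjoint_left]
  intro e he he'
  obtain ⟨h1, h2⟩ := Finset.mem_sdiff.1 he
  exact h2 (Finset.mem_singleton.2 (eq_firstEdge_of_mem h h1
    (Finset.mem_union_left _ (T.boundary_subset_incident _ (Finset.mem_sdiff.1 he').1))))

/-- Summing over the open label merges the fibres into unconstrained sums over all labels. -/
theorem sum_mul_crossContraction (N' N : T.Network r) (S : Finset V) (e : Sym2 V)
    (he : e ∈ T.incident S) (G : Matrix (Fin (r e)) (Fin (r e)) ℝ) :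
    ∑ k', ∑ k, G k' k * crossContraction N' N S e he k' k =
      ∑ β' : LabelIdx r (T.incident S), ∑ β : LabelIdx r (T.incident S),
        ∑ α : LabelIdx T.modeSize (T.modes ∩ S), G (β' ⟨e, he⟩) (β ⟨e, he⟩) *
          (deltaProd (T.boundary S \ {e}) β' β * (nodeProd N' S α β' * nodeProd N S α β)) := by
  rw [← Finset.sum_fiberwise _ (fun β' : LabelIdx r (T.incident S) => β' ⟨e, he⟩)]
  refine Finset.sum_congr rfl fun k' _ => ?_
  simp only [crossContraction, Matrix.of_apply, Finset.mul_sum]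
  rw [Finset.sum_comm]
  refine Finset.sum_congr rfl fun β' hβ' => ?_
  rw [← Finset.sum_fiberwise _ (fun β : LabelIdx r (T.incident S) => β ⟨e, he⟩)]
  refine Finset.sum_congr rfl fun k _ => Finset.sum_congr rfl fun β hβ => ?_
  rw [(Finset.mem_filter.1 hβ').2, (Finset.mem_filter.1 hβ).2]

/-- Inserting two standard basis vectors for the root reduces the contraction over the root and
the path to the contraction over the path alone. -/
theorem sum_gramInv_mul_crossContraction (N : T.Network r) (h : v ≠ c) (γ : ℝ)
    (x' x : T.NodeIdx r c) :
    ∑ k', ∑ k, gramInv N h γ k' k *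
        crossContraction (Function.update N c (EuclideanSpace.single x' 1))
          (Function.update N c (EuclideanSpace.single x 1))
          (insert c (T.between c v)) s(T.pred c v, v)
          (T.edge_mem_incident (T.adj_pred h) (Or.inl (T.pred_mem h))) k' k =
      kronecker x'.1 x.1 *
        deltaProd (T.incident {c} \ {s(c, T.firstStep c v)}) x'.2 x.2 *
        pathContraction N h γ
          (x'.2 ⟨s(c, T.firstStep c v), T.firstEdge_mem_incident h⟩)
          (x.2 ⟨s(c, T.firstStep c v), T.firstEdge_mem_incident h⟩) := by
  set p := T.between c v with hp
  set F := T.incident p ∪ {s(c, T.firstStep c v), s(T.pred c v, v)} with hF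
  have hcp : c ∉ p := fun h' => (mem_between T |>.1 h').2.1 rfl
  have he₁ : s(c, T.firstStep c v) ∈ F :=
    Finset.mem_union_right _ (Finset.mem_insert_self _ _)
  have heHat : s(T.pred c v, v) ∈ F :=
    Finset.mem_union_right _ (Finset.mem_insert_of_mem (Finset.mem_singleton_self _))
  have hq : s(T.pred c v, v) ∈ T.incident (insert c p) :=
    T.edge_mem_incident (T.adj_pred h) (Or.inl (T.pred_mem h))
  have hcq : ({c} : Finset V) ⊆ insert c p := by simp
  have hpq : p ⊆ insert c p := Finset.subset_insert _ _
  have hEc : T.incident {c} ⊆ T.incident (insert c p) := T.incident_mono hcq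
  have hEF : F ⊆ T.incident (insert c p) := pathEdges_subset h
  have hcover : T.incident (insert c p) ⊆ T.incident {c} ∪ F := by
    rw [hp, incident_insert_root]
    exact Finset.union_subset_union_right Finset.subset_union_left
  have hdisj : Disjoint {c} p := Finset.disjoint_singleton_left.2 hcp
  have hnode : ∀ y, nodeProd (Function.update N c y) p = nodeProd N p := fun y =>
    nodeProd_congr fun u hu => Function.update_of_ne (ne_of_mem_of_not_mem hu hcp) _ _
  -- The summand, separated into root and path variables, is kept opaque while sums are split; its
  -- two indicators are the entries of the unit vectors at the root.
  obtain ⟨g, hg⟩ : ∃ g : LabelIdx T.modeSize (T.modes ∩ {c}) → LabelIdx T.modeSize (T.modes ∩ p) →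
    LabelIdx r (T.incident {c}) → LabelIdx r F → LabelIdx r (T.incident {c}) → LabelIdx r F → ℝ,
    g = fun α₁ α₂ β'₁ β'₂ β₁ β₂ =>
      ((if (α₁, β'₁) = x' then 1 else 0) * (if (α₁, β₁) = x then 1 else 0)) *
      (deltaProd (T.incident {c} \ {s(c, T.firstStep c v)}) β'₁ β₁ *
      (deltaProd (T.boundary p \ {s(c, T.firstStep c v), s(T.pred c v, v)}) β'₂ β₂ *
        (nodeProd N p α₂ (restrictIdx Finset.subset_union_left β'₂) *
          nodeProd N p α₂ (restrictIdx Finset.subset_union_left β₂)) *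
        gramInv N h γ (β'₂ ⟨_, heHat⟩) (β₂ ⟨_, heHat⟩))) := ⟨_, rfl⟩
  have hα : ∀ β' β : LabelIdx r (T.incident (insert c p)),
      ∑ α : LabelIdx T.modeSize (T.modes ∩ insert c p),
        gramInv N h γ (β' ⟨_, hq⟩) (β ⟨_, hq⟩) *
          (deltaProd (T.boundary (insert c p) \ {s(T.pred c v, v)}) β' β *
          (nodeProd (Function.update N c (EuclideanSpace.single x' 1)) (insert c p) α β' *
            nodeProd (Function.update N c (EuclideanSpace.single x 1)) (insert c p) α β)) =
      ∑ α₁, ∑ α₂, g α₁ α₂ (restrictIdx hEc β') (restrictIdx hEF β') (restrictIdx hEc β)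
        (restrictIdx hEF β) := by
    intro β' β
    rw [← sum_restrictIdx_disjoint (Finset.inter_subset_inter_left hcq)
      (Finset.inter_subset_inter_left hpq)
      (by rw [Finset.insert_eq, Finset.inter_union_distrib_left])
      (hdisj.mono Finset.inter_subset_right Finset.inter_subset_right)
      (fun α₁ α₂ => g α₁ α₂ (restrictIdx hEc β') (restrictIdx hEF β') (restrictIdx hEc β)
        (restrictIdx hEF β))]
    refine Finset.sum_congr rfl fun α _ => ?_
    rw [nodeProd_union _ hcq hpq (Finset.insert_eq c p).subset hdisj,
      nodeProd_union _ hcq hpq (Finset.insert_eq c p).subset hdisj, hnode, hnode,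
      nodeProd_singleton, nodeProd_singleton, Function.update_self, Function.update_self,
      boundary_insert_root h, deltaProd_union (disjoint_rootEdges_pathEdges h),
      PiLp.single_apply, PiLp.single_apply,
      ← deltaProd_restrictIdx hEc (Finset.inter_subset_left.trans Finset.sdiff_subset),
      ← deltaProd_restrictIdx hEF (Finset.inter_subset_left.trans (Finset.sdiff_subset.trans
        ((T.boundary_subset_incident _).trans Finset.subset_union_left)))]
    simp only [hg]
    simp only [restrictIdx_restrictIdx, restrictIdx_apply]
    ring
  rw [sum_mul_crossContraction]
  refine (Finset.sum_congr rfl fun β' _ => Finset.sum_congr rfl fun β _ => hα β' β).trans ?_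
  refine (sum_sum_restrictIdx_glue hEc hEF hcover (T.firstEdge_mem_incident h) he₁
    (fun e he he' => eq_firstEdge_of_mem h he he')
    (fun β'₁ β'₂ β₁ β₂ => ∑ α₁, ∑ α₂, g α₁ α₂ β'₁ β'₂ β₁ β₂)).trans ?_
  -- The indicator fixes all edge labels at the root; the gluing condition then fixes the label of
  -- the first edge on the path side, which is the open index of M.
  rw [Finset.sum_eq_single x'.2 (fun β'₁ _ hne => by
    have : ∀ α₁, (α₁, β'₁) ≠ x' := fun α₁ h' => hne (congrArg Prod.snd h')
    simp [hg, this]) (by simp)]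
  simp only [pathContraction, Matrix.of_apply, Finset.mul_sum]
  refine Finset.sum_congr rfl fun β'₂ _ => ?_
  rw [Finset.sum_eq_single x.2 (fun β₁ _ hne => by
    have : ∀ α₁, (α₁, β₁) ≠ x := fun α₁ h' => hne (congrArg Prod.snd h')
    simp [hg, this]) (by simp)]
  refine Finset.sum_congr rfl fun β₂ _ => ?_
  rw [Finset.sum_comm]
  refine Finset.sum_congr rfl fun α₂ _ => ?_
  simp only [hg, ← Finset.sum_mul]
  -- Both unit vectors are read at the same mode label, so the sum over it is 1 exactly when their
  -- mode labels agree.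
  have hkr : ∑ α₁ : LabelIdx T.modeSize (T.modes ∩ {c}),
      ((if (α₁, x'.2) = x' then (1 : ℝ) else 0) * (if (α₁, x.2) = x then 1 else 0)) =
      kronecker x'.1 x.1 := by
    rw [Finset.sum_eq_single x'.1 (fun α₁ _ hne => by
      rw [if_neg fun h' => hne (congrArg Prod.fst h'), zero_mul]) (by simp)]
    simp [kronecker, Prod.ext_iff]
  rw [hkr]
  ring

end Path

end TensorTree

/-! ### The main theorem -/

theorem mainTheorem4 {V : Type*} [Fintype V] [DecidableEq V]
    (T : TensorTree V) (K : Finset (Finset V))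
    (hK : IsHierarchical T.modes K) (hT : T.CorrespondsTo K)
    (r : Finset V → ℕ) (N : T.Network (fun e => r (T.edgeModes K e)))
    (c : V) (S : Finset (Finset V)) (hS : S ⊆ K)
    (hSc : switchFamily T.modes K S = (Finset.univ.erase c).image (T.modesBelow c))
    (hY : ∀ (w : V) (hw : w ≠ c), T.modesBelow c w ∈ switchFamily T.modes K S →
      (TensorTree.innerFactor N hw).transpose * TensorTree.innerFactor N hw = 1)
    (γ : ℝ) (hγ : 0 < γ)
    (v : V) (hv : v ≠ c) (hJ : T.modesBelow c v ∈ switchFamily T.modes K S) :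
    (∀ W : Matrix (LabelIdx T.modeSize (T.modesBelow c v))
        (LabelIdx T.modeSize (T.modesBelow c v)) ℝ,
      W = fullWeight T.modeSize (subset_of_mem_switchFamily hK hJ) γ (TensorTree.represent N) ∨
        W = TensorTree.lowRankWeight N hv γ →
      ∀ x' x : T.NodeIdx (fun e => r (T.edgeModes K e)) c,
        TensorTree.pullbackMatrix N c
            (weightOperator T.modeSize (subset_of_mem_switchFamily hK hJ) W) x' x =
          kronecker x'.1 x.1 *
            TensorTree.deltaProd (T.incident {c} \ {s(c, T.firstStep c v)}) x'.2 x.2 *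
            TensorTree.pathContraction N hv γ
              (x'.2 ⟨s(c, T.firstStep c v), T.firstEdge_mem_incident hv⟩)
              (x.2 ⟨s(c, T.firstStep c v), T.firstEdge_mem_incident hv⟩)) ∧
      TensorTree.gram N hv = TensorTree.rootPathContraction N hv := by
  -- The switched family consists of the mode sets below all vertices other than `c`, so
  -- orthonormality holds for every branch, including those without a role in the family member
  -- chosen.
  have hY' : ∀ (w : V) (hw : w ≠ c),
      (TensorTree.innerFactor N hw).transpose * TensorTree.innerFactor N hw = 1 := fun w hw =>
    hY w hw (hSc ▸ Finset.mem_image_of_mem _ (Finset.mem_erase.2 ⟨hw, Finset.mem_univ w⟩))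
  refine ⟨fun W hW x' x => ?_, TensorTree.gram_eq_rootPathContraction hY' hv⟩
  exact (TensorTree.pullbackMatrix_weightOperator hY' hv hγ _ hW x' x).trans
    (TensorTree.sum_gramInv_mul_crossContraction N hv γ x' x)
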